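/- **Setting.** Let $\mathcal V=(\mathcal V,\otimes,k)$ be a commutative unital quantale with $\bot\neq k$ and internal hom $\hom$, and let $\mathscr T=(\mathbb T,\mathcal V,\xi)$ be a (strict) topological theory with $T1=1$: $\mathbb T=(T,e,m)$ is a monad on $\mathbf{Set}$ such that $T$ preserves weak pullbacks and the naturality squares of $m$ are weak pullbacks; $\xi:T\mathcal V\to\mathcal V$ is a $\mathbb T$-algebra structure for which $\otimes:\mathcal V\times\mathcal V\to\mathcal V$ and $k:1\to\mathcal V$ are $\mathbb T$-homomorphisms; and the maps $\mathcal V^X\to\mathcal V^{TX}$, $\varphi\mapsto\xi\cdot T\varphi$, are monotone and natural with respect to $P_{\mathcal V}$, where $P_{\mathcal V}f(\varphi)(y)=\bigvee_{f(x)=y}\varphi(x)$. For $r:X\times Y\to\mathcal V$ put $T_\xi r(\mathfrak x,\mathfrak y)=\bigvee\{\xi(Tr(\mathfrak w))\mid \mathfrak w\in T(X\times Y),\,T\pi_1(\mathfrak w)=\mathfrak x,\,T\pi_2(\mathfrak w)=\mathfrak y\}$. Compose $\mathcal V$-relations by $(s\cdot r)(x,z)=\bigvee_y r(x,y)\otimes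 s(y,z)$, write $r^\circ(y,x)=r(x,y)$, and regard a map as the $\mathcal V$-relation with value $k$ on its graph and $\bot$ elsewhere. The Kleisli convolution of $\alpha:TX\times Y\to\mathcal V$ and $\beta:TY\times Z\to\mathcal V$ is $\beta\circ\alpha=\beta\cdot T_\xi\alpha\cdot m_X^\circ$. A $\mathscr T$-category is a set $X$ with $a:TX\times X\to\mathcal V$ such that $k\le a(e_X(x),x)$ and $T_\xi a(\mathfrak X,\mathfrak x)\otimes a(\mathfrak x,x)\le a(m_X(\mathfrak X),x)$. A $\mathscr T$-functor $f:(X,a)\to(Y,b)$ is a map with $a(\mathfrak x,x)\le b(Tf(\mathfrak x),f(x))$. These form the category $\mathbf{Cat}(\mathscr T)$. $\mathscr T$-functors $f,g:X\to Y$ are ordered by $f\le g$ iff $b(\mathfrak y,f(x))\le b(\mathfrak y,g(x))$ for all $\mathfrak y,x$; $f:X\to Y$ is left adjoint to $g:Y\to X$ if $1_X\le gf$ and $fg\le 1_Y$; and $X$ is separated if $f\le g\le f$ implies $f=g$ for all $\mathscr T$-functors $f,g$ into $X$. A $\mathscr T$-distributor $\varphi$ from $(X,a)$ to $(Y,b)$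 is a map $\varphi:TX\times Y\to\mathcal V$ with $\varphi\circ a\le\varphi$ and $b\circ\varphi\le\varphi$. Put $G=(1,e_1^\circ)$. *Limits.* A limit of a $\mathscr T$-functor $h:A\to X$ weighted by a $\mathscr T$-distributor $\varphi$ from $G$ to $A$ is an element $x_0\in X$ such that, writing $\varphi(z)$ for $\varphi(e_1(*),z)$, $$a(\mathfrak x,x_0)=\bigwedge_{z\in A}\hom(\varphi(z),a(\mathfrak x,h(z)))\qquad\text{for all }\mathfrak x\in TX .$$ $X$ is complete if all such weighted limits (for all $A$, $h$, $\varphi$) exist in $X$. A $\mathscr T$-functor $f:X\to Y$ is continuous if, whenever $x_0$ is a limit in $X$ of $h$ weighted by $\varphi$, $f(x_0)$ is a limit of $f\cdot h$ weighted by $\varphi$. *The monad $\mathbb V=(V,\mathsf y,\mathsf w)$ on $\mathbf{Cat}(\mathscr T)$.* $VX=(\mathcal V^X)^{\mathrm{op}}$: its elements are the maps $\varphi:X\to\mathcal V$ that are $\mathscr T$-functors $G\otimes X\to(\mathcal V,\hom(\xi(-),-))$, equivalently the $\mathscr T$-distributors from $G$ to $X$; its structure sends $(\mathfrak p,\varphi)$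 to $\bigwedge_{x}\hom(\varphi(x),\mu(\mathfrak p,x))$, where $\mu=a\cdot T_\xi\mathrm{ev}$ and $\mathrm{ev}(\varphi,x)=\varphi(x)$. For a $\mathscr T$-functor $f:(X,a)\to(Y,b)$, $Vf=f_\circledast\circ-$ with $f_\circledast(\mathfrak x,y)=b(Tf(\mathfrak x),y)$. The unit is $\mathsf y_X:X\to VX$, $x\mapsto a(e_X(x),-)$, and the multiplication is $\mathsf w_X=\mathsf y_X^\circledast\circ-:VVX\to VX$, where $\mathsf y_X^\circledast(\mathfrak p,x)$ is the value of the structure of $VX$ at $(\mathfrak p,\mathsf y_X(x))$. **Theorem.** 1. A $\mathscr T$-category $X$ is complete if and only if $\mathsf y_X:X\to VX$ has a right adjoint in $\mathbf{Cat}(\mathscr T)$. 2. The category $(\mathbf{Cat}(\mathscr T))^{\mathbb V}$ of Eilenberg–Moore algebras of $\mathbb V$ is precisely the category of complete and separated $\mathscr T$-categories and continuous $\mathscr T$-functors: the functor that forgets the algebra structure, $(X,\alpha)\mapsto X$, is an isomorphism of categories (bijective on objects and fully faithful) from $(\mathbf{Cat}(\mathscr T))^{\mathbb V}$ onto the category of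 complete separated $\mathscr T$-categories and continuous $\mathscr T$-functors, compatible with the forgetful functors to $\mathbf{Cat}(\mathscr T)$. -/

import Mathlib

open CategoryTheory Quantale

universe u

/-! ## Monads on sets and topological theories -/

section MonadOnSets

variable (T : CategoryTheory.Monad (Type u)) {X Y Z : Type u}

/-- The action `T f : T X → T Y` of a monad on sets on a map. -/
def tmap (f : X → Y) (t : T.obj X) : T.obj Y := T.map (↾f) t

/-- The unit `e_X : X → T X`. -/
def tunit (x : X) : T.obj X := T.η.app X x

/-- The multiplication `m_X : T T X → T X`. -/
def tmult (t : T.obj (T.obj X)) : T.obj X := T.μ.app X t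

theorem tmap_id (t : T.obj X) : tmap T (fun x => x) t = t := by
  have := T.map_id X
  exact types_congr_hom this t

theorem tmap_tmap (g : Y → Z) (f : X → Y) (t : T.obj X) :
    tmap T g (tmap T f t) = tmap T (fun x => g (f x)) t := by
  have := T.map_comp (↾f) (↾g)
  exact (types_congr_hom this t).symm

theorem tmap_tunit (f : X → Y) (x : X) : tmap T f (tunit T x) = tunit T (f x) := by
  have := T.η.naturality (↾f)
  exact (types_congr_hom this x).symm

theorem tmap_tmult (f : X → Y) (t : T.obj (T.obj X)) :
    tmap T f (tmult T t) = tmult T (tmap T (tmap T f) t) := by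
  have := T.μ.naturality (↾f)
  exact (types_congr_hom this t).symm

theorem tmult_tunit (t : T.obj X) : tmult T (tunit T t) = t :=
  types_congr_hom (T.left_unit X) t

theorem tmult_tmap_tunit (t : T.obj X) : tmult T (tmap T (tunit T) t) = t :=
  types_congr_hom (T.right_unit X) t

end MonadOnSets

/-- A weak pullback square of sets (`p`, `q` the projections, `f`, `g` the cospan). -/
def IsWeakPullback {P X Y Z : Type u} (p : P → X) (q : P → Y) (f : X → Z) (g : Y → Z) : Prop :=
  (∀ w, f (p w) = g (q w)) ∧ ∀ x y, f x = g y → ∃ w, p w = x ∧ q w = y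

/-- `P_V f : V^X → V^Y`, the left adjoint of the inverse image map `V^Y → V^X`. -/
def pushV {V : Type u} [CompleteLattice V] {X Y : Type u} (f : X → Y) (φ : X → V) : Y → V :=
  fun y => ⨆ (x : X) (_ : f x = y), φ x

/-- A (strict) topological theory `(T, V, ξ)` with underlying quantale `V`: the functor `T`
preserves weak pullbacks, the naturality squares of `m` are weak pullbacks, `(V, ξ)` is an
Eilenberg-Moore algebra, `⊗` and `k` are algebra homomorphisms, and the maps
`V^X → V^{TX}`, `φ ↦ ξ · T φ`, are monotone and natural, as morphisms from `P_V X` to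
`P_V (T X)`. -/
structure TopologicalTheory (V : Type u) [CommMonoid V] [CompleteLattice V] [IsQuantale V] where
  T : CategoryTheory.Monad (Type u)
  ξ : T.obj V → V
  map_weakPullback : ∀ {P X Y Z : Type u} (p : P → X) (q : P → Y) (f : X → Z) (g : Y → Z),
    IsWeakPullback p q f g → IsWeakPullback (tmap T p) (tmap T q) (tmap T f) (tmap T g)
  mult_weakPullback : ∀ {X Y : Type u} (f : X → Y),
    IsWeakPullback (tmult T) (tmap T (tmap T f)) (tmap T f) (tmult T)
  ξ_unit : ∀ v : V, ξ (tunit T v) = v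
  ξ_mult : ∀ v : T.obj (T.obj V), ξ (tmap T ξ v) = ξ (tmult T v)
  ξ_mul : ∀ w : T.obj (V × V),
    ξ (tmap T (fun p => p.1 * p.2) w) = ξ (tmap T Prod.fst w) * ξ (tmap T Prod.snd w)
  ξ_one : ∀ t : T.obj PUnit.{u + 1}, ξ (tmap T (fun _ => 1) t) = 1
  ξ_mono : ∀ {X : Type u} (φ ψ : X → V), φ ≤ ψ → ∀ t : T.obj X, ξ (tmap T φ t) ≤ ξ (tmap T ψ t)
  ξ_natural : ∀ {X Y : Type u} (f : X → Y) (φ : X → V) (t : T.obj Y),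
    ξ (tmap T (pushV f φ) t) = pushV (tmap T f) (fun s => ξ (tmap T φ s)) t

namespace TopologicalTheory

variable {V : Type u} [CommMonoid V] [CompleteLattice V] [IsQuantale V]
variable (𝒯 : TopologicalTheory V) {X Y Z W : Type u}

/-- The object part of the monad of the theory. -/
abbrev F (X : Type u) : Type u := 𝒯.T.obj X

/-- The map part of the monad of the theory. -/
abbrev map (f : X → Y) : 𝒯.F X → 𝒯.F Y := tmap 𝒯.T f

/-- The unit of the monad of the theory. -/
abbrev e (x : X) : 𝒯.F X := tunit 𝒯.T x

/-- The multiplication of the monad of the theory. -/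
abbrev m (t : 𝒯.F (𝒯.F X)) : 𝒯.F X := tmult 𝒯.T t

/-- `ξ_X : V^X → V^{TX}`, `φ ↦ ξ · T φ`. -/
def ξT (φ : X → V) (t : 𝒯.F X) : V := 𝒯.ξ (𝒯.map φ t)

/-- Composition `s · r` of `V`-relations. -/
def relComp (s : Y → Z → V) (r : X → Y → V) : X → Z → V :=
  fun x z => ⨆ y, r x y * s y z

/-- The opposite `r°` of a `V`-relation. -/
def relOp (r : X → Y → V) : Y → X → V := fun y x => r x y

/-- A map as a `V`-relation: value `k` on the graph and `⊥` elsewhere. -/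
def graph (f : X → Y) : X → Y → V := fun x y => ⨆ (_ : f x = y), (1 : V)

/-- The extension `T_ξ` of `T` to `V`-relations. -/
def ext (r : X → Y → V) : 𝒯.F X → 𝒯.F Y → V := fun x y =>
  ⨆ (w : 𝒯.F (X × Y)) (_ : 𝒯.map Prod.fst w = x ∧ 𝒯.map Prod.snd w = y),
    𝒯.ξT (fun p => r p.1 p.2) w

/-- Kleisli convolution `β ∘ α = β · T_ξ α · m°` of `𝒯`-relations. -/
def kleisli (β : 𝒯.F Y → Z → V) (α : 𝒯.F X → Y → V) : 𝒯.F X → Z → V :=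
  relComp β (relComp (𝒯.ext α) (relOp (graph 𝒯.m)))

/-! ### Elementary facts about `ξ` and `T_ξ` -/

theorem map_id (t : 𝒯.F X) : 𝒯.map (fun x => x) t = t := tmap_id _ t

theorem map_map (g : Y → Z) (f : X → Y) (t : 𝒯.F X) :
    𝒯.map g (𝒯.map f t) = 𝒯.map (fun x => g (f x)) t := tmap_tmap _ g f t

theorem map_e (f : X → Y) (x : X) : 𝒯.map f (𝒯.e x) = 𝒯.e (f x) := tmap_tunit _ f x

theorem map_m (f : X → Y) (t : 𝒯.F (𝒯.F X)) :
    𝒯.map f (𝒯.m t) = 𝒯.m (𝒯.map (𝒯.map f) t) := tmap_tmult _ f t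

theorem m_e (t : 𝒯.F X) : 𝒯.m (𝒯.e t) = t := tmult_tunit _ t

theorem m_map_e (t : 𝒯.F X) : 𝒯.m (𝒯.map (fun x => 𝒯.e x) t) = t := tmult_tmap_tunit _ t

theorem exists_of_isWeakPullback {P : Type u} {p : P → X} {q : P → Y} {f : X → Z} {g : Y → Z}
    (h : IsWeakPullback p q f g) {x : 𝒯.F X} {y : 𝒯.F Y} (hxy : 𝒯.map f x = 𝒯.map g y) :
    ∃ w, 𝒯.map p w = x ∧ 𝒯.map q w = y :=
  (𝒯.map_weakPullback p q f g h).2 x y hxy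

theorem iSup_mul_le {ι : Sort*} {f : ι → V} {u v : V} (h : ∀ i, f i * u ≤ v) :
    (⨆ i, f i) * u ≤ v := by
  rw [← leftMulResiduation_le_iff_mul_le]
  exact iSup_le fun i => leftMulResiduation_le_iff_mul_le.2 (h i)

theorem ξT_tunit (φ : X → V) (x : X) : 𝒯.ξT φ (𝒯.e x) = φ x := by
  unfold ξT; rw [map_e]; exact 𝒯.ξ_unit _

theorem ξT_map (f : X → Y) (φ : Y → V) (t : 𝒯.F X) :
    𝒯.ξT φ (𝒯.map f t) = 𝒯.ξT (fun x => φ (f x)) t := by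
  unfold ξT; rw [map_map]

theorem ξT_m (φ : X → V) (t : 𝒯.F (𝒯.F X)) : 𝒯.ξT φ (𝒯.m t) = 𝒯.ξT (𝒯.ξT φ) t := by
  unfold ξT
  rw [map_m]
  refine (𝒯.ξ_mult _).symm.trans ?_
  exact congrArg 𝒯.ξ (𝒯.map_map _ _ _)

theorem ξT_mono {φ ψ : X → V} (h : ∀ x, φ x ≤ ψ x) (t : 𝒯.F X) : 𝒯.ξT φ t ≤ 𝒯.ξT ψ t :=
  𝒯.ξ_mono φ ψ h t

theorem ξT_mul (φ ψ : X → V) (t : 𝒯.F X) :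
    𝒯.ξT (fun x => φ x * ψ x) t = 𝒯.ξT φ t * 𝒯.ξT ψ t := by
  have := 𝒯.ξ_mul (𝒯.map (fun x => (φ x, ψ x)) t)
  simp only [tmap_tmap] at this
  exact this

theorem ξT_one (t : 𝒯.F X) : 𝒯.ξT (fun _ => (1 : V)) t = 1 := by
  have := 𝒯.ξ_one (𝒯.map (fun _ => PUnit.unit) t)
  simp only [tmap_tmap] at this
  exact this

theorem ξT_pushV (f : X → Y) (φ : X → V) (t : 𝒯.F Y) :
    𝒯.ξT (pushV f φ) t = ⨆ (s : 𝒯.F X) (_ : 𝒯.map f s = t), 𝒯.ξT φ s :=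
  𝒯.ξ_natural f φ t

theorem ξT_iSup (g : Y → X → V) (t : 𝒯.F X) :
    𝒯.ξT (fun x => ⨆ y, g y x) t =
      ⨆ (w : 𝒯.F (Y × X)) (_ : 𝒯.map Prod.snd w = t), 𝒯.ξT (fun p => g p.1 p.2) w := by
  rw [← ξT_pushV]
  congr 1
  funext x
  apply le_antisymm
  · exact iSup_le fun y => le_iSup₂_of_le (y, x) rfl le_rfl
  · refine iSup₂_le ?_
    rintro ⟨y, x'⟩ rfl
    exact le_iSup (fun y => g y x') y

theorem le_ext (r : X → Y → V) (w : 𝒯.F (X × Y)) :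
    𝒯.ξT (fun p => r p.1 p.2) w ≤ 𝒯.ext r (𝒯.map Prod.fst w) (𝒯.map Prod.snd w) :=
  le_iSup₂_of_le w ⟨rfl, rfl⟩ le_rfl

theorem ext_le {r : X → Y → V} {x : 𝒯.F X} {y : 𝒯.F Y} {v : V}
    (h : ∀ w, 𝒯.map Prod.fst w = x → 𝒯.map Prod.snd w = y →
      𝒯.ξT (fun p => r p.1 p.2) w ≤ v) : 𝒯.ext r x y ≤ v :=
  iSup₂_le fun w hw => h w hw.1 hw.2

theorem ext_mul_le {r : X → Y → V} {x : 𝒯.F X} {y : 𝒯.F Y} {u v : V}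
    (h : ∀ w, 𝒯.map Prod.fst w = x → 𝒯.map Prod.snd w = y →
      𝒯.ξT (fun p => r p.1 p.2) w * u ≤ v) : 𝒯.ext r x y * u ≤ v := by
  rw [← leftMulResiduation_le_iff_mul_le]
  exact 𝒯.ext_le fun w h1 h2 => leftMulResiduation_le_iff_mul_le.2 (h w h1 h2)

theorem ext_mono {r s : X → Y → V} (h : ∀ x y, r x y ≤ s x y) (x : 𝒯.F X) (y : 𝒯.F Y) :
    𝒯.ext r x y ≤ 𝒯.ext s x y :=
  𝒯.ext_le fun w h1 h2 => by
    subst h1 h2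
    exact (𝒯.ξT_mono (fun p => h p.1 p.2) w).trans (𝒯.le_ext s w)

/-- `T_ξ (s · (f × g)) ≤ T_ξ s · (T f × T g)`. -/
theorem ext_comap_le (f : X → Z) (g : Y → W) (s : Z → W → V) (x : 𝒯.F X) (y : 𝒯.F Y) :
    𝒯.ext (fun x y => s (f x) (g y)) x y ≤ 𝒯.ext s (𝒯.map f x) (𝒯.map g y) := by
  refine 𝒯.ext_le fun w h1 h2 => ?_
  subst h1 h2
  have := 𝒯.le_ext s (𝒯.map (fun p : X × Y => (f p.1, g p.2)) w)
  rw [ξT_map] at this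
  simpa only [map_map] using this

theorem ext_comap_left (f : X → Z) (s : Z → Y → V) (x : 𝒯.F X) (y : 𝒯.F Y) :
    𝒯.ext (fun x y => s (f x) y) x y = 𝒯.ext s (𝒯.map f x) y := by
  apply le_antisymm
  · have := 𝒯.ext_comap_le f (fun y => y) s x y
    rwa [map_id] at this
  · refine 𝒯.ext_le fun w h1 h2 => ?_
    have hwp : IsWeakPullback (fun p : X × Y => (f p.1, p.2)) Prod.fst Prod.fst f :=
      ⟨fun _ => rfl, by rintro ⟨z, y⟩ x rfl; exact ⟨(x, y), rfl, rfl⟩⟩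
    obtain ⟨w', h3, h4⟩ := 𝒯.exists_of_isWeakPullback hwp h1
    have := 𝒯.le_ext (fun x y => s (f x) y) w'
    subst h3
    rw [map_map] at h2
    rw [ξT_map]
    rwa [h4, h2] at this

theorem le_ext_tunit (r : X → Y → V) (x : X) (y : Y) :
    r x y ≤ 𝒯.ext r (𝒯.e x) (𝒯.e y) := by
  have := 𝒯.le_ext r (𝒯.e (x, y))
  simpa only [ξT_tunit, map_e] using this

theorem one_le_ext {r : X → X → V} (h : ∀ x, 1 ≤ r x x) (x : 𝒯.F X) : 1 ≤ 𝒯.ext r x x := by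
  have := 𝒯.le_ext r (𝒯.map (fun x => (x, x)) x)
  rw [ξT_map, map_map, map_map, map_id] at this
  refine le_trans ?_ this
  rw [← 𝒯.ξT_one x]
  exact 𝒯.ξT_mono h x

/-- `T_ξ s · T_ξ r ≤ T_ξ (s · r)`. -/
theorem ext_mul_ext_le (s : Y → Z → V) (r : X → Y → V) (x : 𝒯.F X) (y : 𝒯.F Y) (z : 𝒯.F Z) :
    𝒯.ext r x y * 𝒯.ext s y z ≤ 𝒯.ext (relComp s r) x z := by
  refine 𝒯.ext_mul_le fun w h1 h2 => ?_
  rw [mul_comm]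
  refine 𝒯.ext_mul_le fun w' h3 h4 => ?_
  have hwp : IsWeakPullback (fun p : X × Y × Z => (p.1, p.2.1)) (fun p : X × Y × Z => p.2)
      Prod.snd Prod.fst :=
    ⟨fun _ => rfl, by rintro ⟨x, y⟩ ⟨y', z⟩ h; cases h; exact ⟨(x, y, z), rfl, rfl⟩⟩
  obtain ⟨q, rfl, rfl⟩ := 𝒯.exists_of_isWeakPullback hwp (h2.trans h3.symm)
  rw [ξT_map, ξT_map, ← ξT_mul]
  have := 𝒯.le_ext (relComp s r) (𝒯.map (fun p : X × Y × Z => (p.1, p.2.2)) q)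
  rw [map_map] at h1 h4
  rw [map_map, map_map, ξT_map, h1, h4] at this
  refine le_trans (𝒯.ξT_mono (fun p => ?_) q) this
  rw [mul_comm]
  exact le_iSup (fun y => r p.1 y * s y p.2.2) p.2.1

/-- `T_ξ (s · r) ≤ T_ξ s · T_ξ r`. -/
theorem ext_relComp_le (s : Y → Z → V) (r : X → Y → V) (x : 𝒯.F X) (z : 𝒯.F Z) :
    𝒯.ext (relComp s r) x z ≤ ⨆ y, 𝒯.ext r x y * 𝒯.ext s y z := by
  refine 𝒯.ext_le fun w h1 h2 => ?_
  unfold relComp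
  rw [𝒯.ξT_iSup (fun (y : Y) (p : X × Z) => r p.1 y * s y p.2)]
  refine iSup₂_le fun q hq => ?_
  subst hq
  rw [ξT_mul]
  refine le_iSup_of_le (𝒯.map Prod.fst q) (mul_le_mul' ?_ ?_)
  · have := 𝒯.le_ext r (𝒯.map (fun p : Y × X × Z => (p.2.1, p.1)) q)
    rw [map_map] at h1
    rwa [map_map, map_map, ξT_map, h1] at this
  · have := 𝒯.le_ext s (𝒯.map (fun p : Y × X × Z => (p.1, p.2.2)) q)
    rw [map_map] at h2
    rwa [map_map, map_map, ξT_map, h2] at this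

/-- `m_Y · T_ξ T_ξ r ≤ T_ξ r · m_X`. -/
theorem ext_ext_le (r : X → Y → V) (x : 𝒯.F (𝒯.F X)) (y : 𝒯.F (𝒯.F Y)) :
    𝒯.ext (𝒯.ext r) x y ≤ 𝒯.ext r (𝒯.m x) (𝒯.m y) := by
  refine 𝒯.ext_le fun w h1 h2 => ?_
  have key : (fun p : 𝒯.F X × 𝒯.F Y => 𝒯.ext r p.1 p.2) =
      pushV (fun q : 𝒯.F (X × Y) => (𝒯.map Prod.fst q, 𝒯.map Prod.snd q))
        (𝒯.ξT (fun p => r p.1 p.2)) := by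
    funext p
    unfold ext pushV
    simp only [Prod.ext_iff]
  rw [key, ξT_pushV]
  refine iSup₂_le fun q hq => ?_
  subst hq
  rw [map_map] at h1 h2
  subst h1 h2
  have := 𝒯.le_ext r (𝒯.m q)
  rwa [map_m, map_m, ξT_m] at this

theorem le_kleisli (β : 𝒯.F Y → Z → V) (α : 𝒯.F X → Y → V) (x : 𝒯.F (𝒯.F X)) (y : 𝒯.F Y)
    (z : Z) : 𝒯.ext α x y * β y z ≤ 𝒯.kleisli β α (𝒯.m x) z := by
  unfold kleisli relComp relOp graph
  refine le_iSup_of_le y (mul_le_mul' ?_ le_rfl)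
  refine le_iSup_of_le x ?_
  simp

theorem kleisli_le {β : 𝒯.F Y → Z → V} {α : 𝒯.F X → Y → V} {t : 𝒯.F X} {z : Z} {v : V}
    (h : ∀ x y, 𝒯.m x = t → 𝒯.ext α x y * β y z ≤ v) : 𝒯.kleisli β α t z ≤ v := by
  unfold kleisli relComp relOp graph
  refine iSup_le fun y => ?_
  refine iSup_mul_le fun x => ?_
  rw [mul_assoc]
  refine iSup_mul_le fun hx => ?_
  rw [one_mul]
  exact h x y hx

/-! ## `𝒯`-categories, `𝒯`-functors and `𝒯`-distributors -/

/-- A map compatible with two `𝒯`-graph structures. -/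
def IsFunctor (a : 𝒯.F X → X → V) (b : 𝒯.F Y → Y → V) (f : X → Y) : Prop :=
  ∀ t x, a t x ≤ b (𝒯.map f t) (f x)

end TopologicalTheory

open TopologicalTheory

variable {V : Type u} [CommMonoid V] [CompleteLattice V] [IsQuantale V]

/-- A `𝒯`-category `(X, a)`. -/
structure TCat (𝒯 : TopologicalTheory V) where
  carrier : Type u
  str : 𝒯.F carrier → carrier → V
  refl : ∀ x, 1 ≤ str (𝒯.e x) x
  trans : ∀ (s : 𝒯.F (𝒯.F carrier)) (t : 𝒯.F carrier) (x : carrier),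
    𝒯.ext str s t * str t x ≤ str (𝒯.m s) x

namespace TCat

variable {𝒯 : TopologicalTheory V}

/-- A `𝒯`-functor. -/
@[ext]
structure Hom (X Y : TCat 𝒯) where
  toFun : X.carrier → Y.carrier
  isFunctor : 𝒯.IsFunctor X.str Y.str toFun

instance : Category (TCat 𝒯) where
  Hom := Hom
  id X := ⟨fun x => x, fun t x => by rw [map_id]⟩
  comp f g := ⟨fun x => g.toFun (f.toFun x), fun t x => by
    rw [← map_map]
    exact (f.isFunctor t x).trans (g.isFunctor _ _)⟩

@[ext]
theorem hom_ext {X Y : TCat 𝒯} {f g : X ⟶ Y} (h : ∀ x, f.toFun x = g.toFun x) : f = g :=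
  Hom.ext (funext h)

/-- `f_⊛ = b · T f`. -/
def lowerStar {X : Type u} (Y : TCat 𝒯) (f : X → Y.carrier) : 𝒯.F X → Y.carrier → V :=
  fun t y => Y.str (𝒯.map f t) y

/-- `f^⊛ = f° · b`. -/
def upperStar {X : Type u} (Y : TCat 𝒯) (f : X → Y.carrier) : 𝒯.F Y.carrier → X → V :=
  fun t x => Y.str t (f x)

/-- The order on hom-sets: `f ≤ g` iff `f^⊛ ≤ g^⊛`. -/
instance {X Y : TCat 𝒯} : LE (X ⟶ Y) where
  le f g := ∀ t x, upperStar Y f.toFun t x ≤ upperStar Y g.toFun t x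

/-- `f` is left adjoint to `g` in the 2-category of `𝒯`-categories. -/
def IsAdjoint {X Y : TCat 𝒯} (f : X ⟶ Y) (g : Y ⟶ X) : Prop :=
  𝟙 X ≤ f ≫ g ∧ g ≫ f ≤ 𝟙 Y

/-- `X` is separated: equivalent `𝒯`-functors into `X` are equal. -/
def IsSeparated (X : TCat 𝒯) : Prop :=
  ∀ (Y : TCat 𝒯) (f g : Y ⟶ X), f ≤ g → g ≤ f → f = g

/-- The `𝒯`-category `G = (1, e_1°)`. -/
abbrev G (𝒯 : TopologicalTheory V) : TCat 𝒯 where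
  carrier := PUnit.{u + 1}
  str := relOp (graph (fun x => 𝒯.e x))
  refl x := by simp [relOp, graph]
  trans s t x := by
    refine 𝒯.ext_mul_le fun w h1 h2 => ?_
    have key : (fun p : 𝒯.F PUnit.{u + 1} × PUnit.{u + 1} =>
          relOp (graph (V := V) (fun x => 𝒯.e x)) p.1 p.2) =
        pushV (fun x : PUnit.{u + 1} => (𝒯.e x, x)) (fun _ => (1 : V)) := by
      funext p
      unfold relOp graph pushV
      apply le_antisymm
      · exact iSup_le fun h => le_iSup₂_of_le p.2 (Prod.ext h rfl) le_rfl
      · refine iSup₂_le fun q hq => ?_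
        exact le_iSup_of_le (by rw [← hq]) le_rfl
    rw [key, ξT_pushV]
    refine iSup_mul_le fun q => iSup_mul_le fun hq => ?_
    subst hq
    rw [map_map] at h1 h2
    subst h1 h2
    rw [ξT_one, one_mul, m_map_e, map_id]

/-- `φ : X ⇸ Y` is a `𝒯`-distributor. -/
def IsDistributor (X Y : TCat 𝒯) (φ : 𝒯.F X.carrier → Y.carrier → V) : Prop :=
  (∀ t y, 𝒯.kleisli φ X.str t y ≤ φ t y) ∧ (∀ t y, 𝒯.kleisli Y.str φ t y ≤ φ t y)

/-! ## Weighted limits -/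

/-- The lifting `φ ⊸ ψ` of `ψ : X ⇸ A` along `φ : G ⇸ A`. -/
def lifting {X A : Type u} (φ : 𝒯.F PUnit.{u + 1} → A → V) (ψ : 𝒯.F X → A → V) :
    𝒯.F X → PUnit.{u + 1} → V :=
  fun t p => ⨅ z, φ (𝒯.e p) z ⇨ₗ ψ t z

/-- `x` is a limit of the diagram given by `h : A ⟶ X` and the weight `φ : G ⇸ A`,
that is, `x^⊛ = φ ⊸ h^⊛`. -/
def IsLimit {A X : TCat 𝒯} (h : A ⟶ X) (φ : 𝒯.F PUnit.{u + 1} → A.carrier → V)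
    (x : X.carrier) : Prop :=
  upperStar X (fun _ : PUnit.{u + 1} => x) = lifting φ (upperStar X h.toFun)

/-- `X` is complete: all weighted limits with weights `G ⇸ A` exist in `X`. -/
def IsComplete (X : TCat 𝒯) : Prop :=
  ∀ (A : TCat 𝒯) (h : A ⟶ X) (φ : 𝒯.F PUnit.{u + 1} → A.carrier → V),
    IsDistributor (G 𝒯) A φ → ∃ x, IsLimit h φ x

/-- `f` is continuous: it preserves all weighted limits which exist in `X`. -/
def IsContinuous {X Y : TCat 𝒯} (f : X ⟶ Y) : Prop :=
  ∀ (A : TCat 𝒯) (h : A ⟶ X) (φ : 𝒯.F PUnit.{u + 1} → A.carrier → V),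
    IsDistributor (G 𝒯) A φ → ∀ x, IsLimit h φ x → IsLimit (h ≫ f) φ (f.toFun x)

end TCat

/-- Complete and separated `𝒯`-categories. -/
structure CompleteSepTCat (𝒯 : TopologicalTheory V) where
  toTCat : TCat 𝒯
  complete : toTCat.IsComplete
  separated : toTCat.IsSeparated

namespace CompleteSepTCat

variable {𝒯 : TopologicalTheory V}

/-- Continuous `𝒯`-functors. -/
@[ext]
structure Hom (X Y : CompleteSepTCat 𝒯) where
  hom : X.toTCat ⟶ Y.toTCat
  continuous : TCat.IsContinuous hom

/-- The category of complete separated `𝒯`-categories and continuous `𝒯`-functors. -/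
instance : Category (CompleteSepTCat 𝒯) where
  Hom := Hom
  id X := ⟨𝟙 _, fun _ _ _ _ _ hx => hx⟩
  comp f g := ⟨f.hom ≫ g.hom, fun A h φ hφ x hx =>
    g.continuous A (h ≫ f.hom) φ hφ _ (f.continuous A h φ hφ x hx)⟩

/-- The inclusion into the category of `𝒯`-categories. -/
def incl (𝒯 : TopologicalTheory V) : CompleteSepTCat 𝒯 ⥤ TCat 𝒯 where
  obj X := X.toTCat
  map f := f.hom

end CompleteSepTCat

namespace TCat

variable {𝒯 : TopologicalTheory V}

/-! ## The exponential `V^X` and its dual `V X` -/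

/-- The structure of the tensor product `X ⊗ Y`. -/
def tensorStr (X Y : TCat 𝒯) :
    𝒯.F (X.carrier × Y.carrier) → X.carrier × Y.carrier → V :=
  fun w p => X.str (𝒯.map Prod.fst w) p.1 * Y.str (𝒯.map Prod.snd w) p.2

/-- The structure `hom_ξ` of the `𝒯`-category `V`. -/
def homξ (𝒯 : TopologicalTheory V) : 𝒯.F V → V → V := fun t v => 𝒯.ξ t ⇨ₗ v

/-- The underlying set of the exponential `V^X`: maps `h : X → V` which are `𝒯`-functors of type
`G ⊗ X → V`. -/
@[ext]
structure VPow (X : TCat 𝒯) : Type u where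
  val : X.carrier → V
  isFunctor : 𝒯.IsFunctor (tensorStr (G 𝒯) X) (homξ 𝒯) (fun p => val p.2)

/-- The evaluation map as a `V`-relation from `V^X` to `X`. -/
def ev (X : TCat 𝒯) : X.VPow → X.carrier → V := fun h x => h.val x

/-- The `𝒯`-graph structure of the exponential `V^X`. -/
def expStr (X : TCat 𝒯) : 𝒯.F X.VPow → X.VPow → V := fun p h =>
  ⨅ (q : 𝒯.F (X.VPow × X.carrier)) (x : X.carrier) (_ : 𝒯.map Prod.fst q = p),
    X.str (𝒯.map Prod.snd q) x ⇨ₗ homξ 𝒯 (𝒯.map (fun r => ev X r.1 r.2) q) (h.val x)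

/-- The `V`-relation `μ = a · T_ξ ev`. -/
def mu (X : TCat 𝒯) : 𝒯.F X.VPow → X.carrier → V := relComp X.str (𝒯.ext X.ev)

/-- A map `φ : X → V`, regarded as the `𝒯`-relation `φ · e_1° : 1 ⇸ X`. -/
def ofPoint {X : Type u} (φ : X → V) : 𝒯.F PUnit.{u + 1} → X → V :=
  relComp (fun _ : PUnit.{u + 1} => φ) (relOp (graph (fun x => 𝒯.e x)))

/-- The action `ψ ∘ -` of a `𝒯`-relation `ψ : X ⇸ Y` on maps `X → V`, seen as `𝒯`-relations
from `1`. -/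
def postcomp {X Y : Type u} (ψ : 𝒯.F X → Y → V) (φ : X → V) : Y → V :=
  fun y => 𝒯.kleisli ψ (ofPoint φ) (𝒯.e PUnit.unit) y

theorem expStr_eq (X : TCat 𝒯) (p : 𝒯.F X.VPow) (h : X.VPow) :
    X.expStr p h = ⨅ x, X.mu p x ⇨ₗ h.val x := by
  unfold expStr homξ
  apply le_antisymm
  · refine le_iInf fun x => ?_
    rw [leftMulResiduation_le_iff_mul_le]
    unfold mu relComp
    rw [mul_iSup_distrib]
    refine iSup_le fun t => ?_
    rw [mul_left_comm]
    refine 𝒯.ext_mul_le fun q h1 h2 => ?_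
    subst h1 h2
    rw [mul_left_comm, mul_comm (𝒯.ξT _ _), ← mul_assoc]
    refine leftMulResiduation_le_iff_mul_le.1 (leftMulResiduation_le_iff_mul_le.1 ?_)
    exact (iInf_le _ q).trans ((iInf_le _ x).trans (iInf_le _ rfl))
  · refine le_iInf fun q => le_iInf fun x => le_iInf fun hq => ?_
    subst hq
    rw [leftMulResiduation_le_iff_mul_le, leftMulResiduation_le_iff_mul_le]
    have h3 := iInf_le (fun x => X.mu (𝒯.map Prod.fst q) x ⇨ₗ h.val x) x
    rw [leftMulResiduation_le_iff_mul_le] at h3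
    refine le_trans ?_ h3
    rw [mul_assoc]
    refine mul_le_mul' le_rfl ?_
    rw [mul_comm]
    exact le_iSup_of_le (f := fun y => 𝒯.ext X.ev (𝒯.map Prod.fst q) y * X.str y x)
      (𝒯.map Prod.snd q) (mul_le_mul' (𝒯.le_ext X.ev q) le_rfl)

theorem lowerStar_trans {X Y : TCat 𝒯} (f : X ⟶ Y) (s : 𝒯.F (𝒯.F X.carrier)) (y : 𝒯.F Y.carrier)
    (z : Y.carrier) :
    𝒯.ext (lowerStar Y f.toFun) s y * Y.str y z ≤ lowerStar Y f.toFun (𝒯.m s) z := by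
  unfold lowerStar
  rw [map_m]
  refine le_trans (mul_le_mul' ?_ le_rfl) (Y.trans _ _ _)
  rw [𝒯.ext_comap_left (𝒯.map f.toFun) Y.str]

/-! From here on `T1 = 1`. -/

variable [Subsingleton (𝒯.F PUnit.{u + 1})]

theorem ξT_const {X : Type u} (v : V) (t : 𝒯.F X) : 𝒯.ξT (fun _ => v) t = v := by
  have h : 𝒯.map (fun _ => PUnit.unit.{u + 1}) t = 𝒯.e PUnit.unit := Subsingleton.elim _ _
  have h2 := 𝒯.ξT_map (fun _ : X => PUnit.unit.{u + 1}) (fun _ => v) t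
  rw [← h2, h, ξT_tunit]

theorem str_G (t : 𝒯.F (G 𝒯).carrier) (x : (G 𝒯).carrier) : (G 𝒯).str t x = 1 := by
  have h : 𝒯.e x = t := Subsingleton.elim (α := 𝒯.F PUnit.{u + 1}) _ _
  exact le_antisymm (iSup_le fun _ => le_rfl) (le_iSup_of_le h le_rfl)

/-- Elementwise description of the elements of `V^X`. -/
theorem isFunctor_iff (X : TCat 𝒯) (h : X.carrier → V) :
    𝒯.IsFunctor (tensorStr (G 𝒯) X) (homξ 𝒯) (fun p => h p.2) ↔
      ∀ t x, 𝒯.ξT h t * X.str t x ≤ h x := by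
  constructor
  · intro H t x
    have := H (𝒯.map (fun x => ((PUnit.unit : (G 𝒯).carrier), x)) t) ((PUnit.unit : (G 𝒯).carrier), x)
    unfold tensorStr homξ at this
    rw [str_G, one_mul, leftMulResiduation_le_iff_mul_le, map_map, map_map, map_id] at this
    rw [mul_comm]
    exact this
  · intro H w p
    have := H (𝒯.map Prod.snd w) p.2
    unfold tensorStr homξ
    rw [str_G, one_mul, leftMulResiduation_le_iff_mul_le, mul_comm]
    rwa [ξT_map] at this

theorem VPow.le {X : TCat 𝒯} (h : X.VPow) (t : 𝒯.F X.carrier) (x : X.carrier) :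
    𝒯.ξT h.val t * X.str t x ≤ h.val x :=
  (isFunctor_iff X h.val).1 h.2 t x

theorem VPow.le_tunit {X : TCat 𝒯} (h : X.VPow) (y x : X.carrier) :
    h.val y * X.str (𝒯.e y) x ≤ h.val x := by
  have := h.le (𝒯.e y) x
  rwa [ξT_tunit] at this

/-- `T_ξ r (e x, -) = ξ · T (r (x, -))`. -/
theorem ext_tunit {X Y : Type u} (r : X → Y → V) (x : X) (t : 𝒯.F Y) :
    𝒯.ext r (𝒯.e x) t = 𝒯.ξT (r x) t := by
  have h1 := 𝒯.ext_comap_left (fun _ : PUnit.{u + 1} => x) r (𝒯.e PUnit.unit) t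
  rw [map_e] at h1
  rw [← h1]
  apply le_antisymm
  · refine 𝒯.ext_le fun w h2 h3 => ?_
    rw [← h3, ξT_map]
  · have := 𝒯.le_ext (fun (_ : PUnit.{u + 1}) y => r x y)
      (𝒯.map (fun y => (PUnit.unit, y)) t)
    rw [ξT_map, map_map, map_map, map_id] at this
    refine this.trans (le_of_eq ?_)
    congr 1
    exact Subsingleton.elim _ _

theorem mu_tunit (X : TCat 𝒯) (h : X.VPow) (x : X.carrier) : X.mu (𝒯.e h) x = h.val x := by
  unfold mu relComp
  apply le_antisymm
  · refine iSup_le fun t => ?_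
    rw [ext_tunit]
    exact h.le t x
  · refine le_iSup_of_le (𝒯.e x) ?_
    rw [ext_tunit, ξT_tunit]
    exact le_mul_of_one_le_right' (X.refl x)

/-- For every `p` in `T (V^X)`, the map `μ (p, -)` belongs to `V^X`. -/
theorem isFunctor_mu (X : TCat 𝒯) (p : 𝒯.F X.VPow) :
    𝒯.IsFunctor (tensorStr (G 𝒯) X) (homξ 𝒯) (fun q => X.mu p q.2) := by
  rw [isFunctor_iff]
  intro t x
  rw [show 𝒯.ξT (fun q => X.mu p q) t = 𝒯.ext X.mu (𝒯.e p) t from (ext_tunit X.mu p t).symm]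
  refine le_trans (mul_le_mul' (𝒯.ext_relComp_le _ _ _ _) le_rfl) ?_
  rw [iSup_mul_distrib]
  refine iSup_le fun s => ?_
  rw [mul_assoc]
  refine le_trans (mul_le_mul' (𝒯.ext_ext_le _ _ _) (X.trans s t x)) ?_
  rw [m_e]
  exact le_iSup (fun y => 𝒯.ext X.ev p y * X.str y x) (𝒯.m s)

/-- The map `T (V^X) → V^X` induced by `μ`. -/
def muMap (X : TCat 𝒯) (p : 𝒯.F X.VPow) : X.VPow := ⟨X.mu p, X.isFunctor_mu p⟩

/-- The `𝒯`-graph `V^X` is dualisable: its structure is `d = d_0 · μ`. -/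
theorem expStr_dualisable (X : TCat 𝒯) (p : 𝒯.F X.VPow) (h : X.VPow) :
    X.expStr p h = X.expStr (𝒯.e (X.muMap p)) h := by
  simp only [expStr_eq, mu_tunit]
  rfl

/-- The structure `d_0° · μ` of the dual `(V^X)^op` of the exponential `V^X = (V^X, d_0 · μ)`. -/
def VStr (X : TCat 𝒯) : 𝒯.F X.VPow → X.VPow → V :=
  fun p h => X.expStr (𝒯.e h) (X.muMap p)

theorem le_VStr_iff {X : TCat 𝒯} {p : 𝒯.F X.VPow} {h : X.VPow} {v : V} :
    v ≤ X.VStr p h ↔ ∀ x, v * h.val x ≤ X.mu p x := by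
  unfold VStr
  rw [expStr_eq]
  simp only [mu_tunit, le_iInf_iff, leftMulResiduation_le_iff_mul_le]
  rfl

theorem VStr_mul_le (X : TCat 𝒯) (p : 𝒯.F X.VPow) (h : X.VPow) (x : X.carrier) :
    X.VStr p h * h.val x ≤ X.mu p x :=
  le_VStr_iff.1 le_rfl x

/-- The `𝒯`-category `V X = (V^X)^op`. -/
abbrev Vobj (X : TCat 𝒯) : TCat 𝒯 where
  carrier := X.VPow
  str := X.VStr
  refl h := by
    rw [le_VStr_iff]
    intro x
    rw [mu_tunit, one_mul]
  trans s t h := by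
    rw [le_VStr_iff]
    intro x
    rw [mul_assoc]
    refine le_trans (mul_le_mul' le_rfl (X.VStr_mul_le t h x)) ?_
    unfold mu relComp
    rw [mul_iSup_distrib]
    refine iSup_le fun y => ?_
    rw [← mul_assoc]
    have h1 : 𝒯.ext X.VStr s t * 𝒯.ext X.ev t y ≤ 𝒯.ext X.mu s y := by
      refine (𝒯.ext_mul_ext_le _ _ _ _ _).trans (𝒯.ext_mono (fun p x => ?_) _ _)
      exact iSup_le fun h => X.VStr_mul_le p h x
    refine le_trans (mul_le_mul' h1 le_rfl) ?_
    refine le_trans (mul_le_mul' (𝒯.ext_relComp_le _ _ _ _) le_rfl) ?_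
    rw [iSup_mul_distrib]
    refine iSup_le fun z => ?_
    rw [mul_assoc]
    refine le_trans (mul_le_mul' (𝒯.ext_ext_le _ _ _) (X.trans _ _ _)) ?_
    exact le_iSup (fun y => 𝒯.ext X.ev (𝒯.m s) y * X.str y x) (𝒯.m z)

/-! ## The monad `V` -/

theorem postcomp_apply {X Y : Type u} (ψ : 𝒯.F X → Y → V) (φ : X → V) (y : Y) :
    postcomp ψ φ y = ⨆ t, 𝒯.ξT φ t * ψ t y := by
  have h1 : ∀ (s : 𝒯.F PUnit.{u + 1}), ofPoint (𝒯 := 𝒯) φ s = φ := by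
    intro s
    funext x
    unfold ofPoint relComp relOp graph
    apply le_antisymm
    · exact iSup_le fun p => iSup_mul_le fun _ => (one_mul _).le
    · refine le_iSup_of_le PUnit.unit ?_
      have h : 𝒯.e PUnit.unit.{u + 1} = s := Subsingleton.elim _ _
      simp [h]
  have h2 : ∀ (s : 𝒯.F (𝒯.F PUnit.{u + 1})) (t : 𝒯.F X),
      𝒯.ext (ofPoint (𝒯 := 𝒯) φ) s t ≤ 𝒯.ξT φ t := by
    intro s t
    refine 𝒯.ext_le fun w h2 h3 => ?_
    simp only [h1]
    rw [← h3, ξT_map]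
  have h3 : ∀ (t : 𝒯.F X),
      𝒯.ξT φ t ≤ 𝒯.ext (ofPoint (𝒯 := 𝒯) φ) (𝒯.e (𝒯.e PUnit.unit)) t := by
    intro t
    rw [ext_tunit, h1]
  unfold postcomp
  apply le_antisymm
  · refine 𝒯.kleisli_le fun s t _ => ?_
    exact le_iSup_of_le t (mul_le_mul' (h2 s t) le_rfl)
  · refine iSup_le fun t => ?_
    have := 𝒯.le_kleisli ψ (ofPoint φ) (𝒯.e (𝒯.e PUnit.unit)) t y
    rw [m_e] at this
    exact (mul_le_mul' (h3 t) le_rfl).trans this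

theorem le_postcomp {X Y : Type u} (ψ : 𝒯.F X → Y → V) (φ : X → V) (t : 𝒯.F X) (y : Y) :
    𝒯.ξT φ t * ψ t y ≤ postcomp ψ φ y := by
  rw [postcomp_apply]
  exact le_iSup (fun t => 𝒯.ξT φ t * ψ t y) t

theorem postcomp_le {X Y : Type u} {ψ : 𝒯.F X → Y → V} {φ : X → V} {y : Y} {v : V}
    (h : ∀ t, 𝒯.ξT φ t * ψ t y ≤ v) : postcomp ψ φ y ≤ v := by
  rw [postcomp_apply]
  exact iSup_le h

theorem postcomp_mono {X Y : Type u} (ψ : 𝒯.F X → Y → V) {φ φ' : X → V}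
    (h : ∀ x, φ x ≤ φ' x) (y : Y) : postcomp ψ φ y ≤ postcomp ψ φ' y :=
  postcomp_le fun t => (mul_le_mul' (𝒯.ξT_mono h t) le_rfl).trans (le_postcomp ψ φ' t y)

theorem mul_postcomp_le {X Y : Type u} (ψ : 𝒯.F X → Y → V) {φ φ' : X → V} {v : V}
    (h : ∀ x, v * φ x ≤ φ' x) (y : Y) : v * postcomp ψ φ y ≤ postcomp ψ φ' y := by
  rw [mul_comm, postcomp_apply]
  refine iSup_mul_le fun t => ?_
  rw [mul_right_comm, mul_comm (𝒯.ξT φ t)]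
  refine le_trans (mul_le_mul' ?_ le_rfl) (le_postcomp ψ φ' t y)
  have h1 : v * 𝒯.ξT φ t = 𝒯.ξT (fun x => v * φ x) t := by
    rw [𝒯.ξT_mul (fun _ => v) φ, ξT_const]
  rw [h1]
  exact 𝒯.ξT_mono h t

theorem ξT_postcomp_le {X Y : Type u} (ψ : 𝒯.F X → Y → V) (φ : X → V) (y : 𝒯.F Y) :
    𝒯.ξT (postcomp ψ φ) y ≤ ⨆ s, 𝒯.ξT φ (𝒯.m s) * 𝒯.ext ψ s y := by
  have h : postcomp ψ φ = fun y => ⨆ t, 𝒯.ξT φ t * ψ t y := funext (postcomp_apply ψ φ)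
  rw [h, 𝒯.ξT_iSup (fun t y => 𝒯.ξT φ t * ψ t y)]
  refine iSup₂_le fun w hw => ?_
  subst hw
  rw [ξT_mul]
  refine le_iSup_of_le (𝒯.map Prod.fst w) (mul_le_mul' ?_ (𝒯.le_ext ψ w))
  rw [ξT_m, ξT_map]

/-- `Vf = f_⊛ ∘ -`. -/
def Vmap {X Y : TCat 𝒯} (f : X ⟶ Y) (h : X.VPow) : Y.VPow where
  val := postcomp (lowerStar Y f.toFun) h.val
  isFunctor := by
    rw [isFunctor_iff]
    intro t y
    refine le_trans (mul_le_mul' (ξT_postcomp_le _ _ _) le_rfl) ?_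
    refine iSup_mul_le fun s => ?_
    rw [mul_assoc]
    exact (mul_le_mul' le_rfl (lowerStar_trans f s t y)).trans (le_postcomp _ _ (𝒯.m s) y)

theorem le_Vmap {X Y : TCat 𝒯} (f : X ⟶ Y) (h : X.VPow) (x : X.carrier) :
    h.val x ≤ (Vmap f h).val (f.toFun x) := by
  refine le_trans ?_ (le_postcomp _ _ (𝒯.e x) _)
  unfold lowerStar
  rw [ξT_tunit, map_e]
  exact le_mul_of_one_le_right' (Y.refl _)

theorem Vmap_muMap_le {X Y : TCat 𝒯} (f : X ⟶ Y) (p : 𝒯.F X.VPow) (y : Y.carrier) :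
    (Vmap f (X.muMap p)).val y ≤ Y.mu (𝒯.map (Vmap f) p) y := by
  refine postcomp_le fun t => ?_
  rw [show 𝒯.ξT (X.muMap p).val t = 𝒯.ext X.mu (𝒯.e p) t from (ext_tunit X.mu p t).symm]
  refine le_trans (mul_le_mul' (𝒯.ext_relComp_le _ _ _ _) le_rfl) ?_
  refine iSup_mul_le fun s => ?_
  rw [mul_assoc]
  have h1 : 𝒯.ext X.str s t * lowerStar Y f.toFun t y ≤
      Y.str (𝒯.map f.toFun (𝒯.m s)) y := by
    rw [map_m]
    refine le_trans (mul_le_mul' ?_ le_rfl) (Y.trans _ (𝒯.map f.toFun t) _)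
    refine (𝒯.ext_mono (fun t x => f.isFunctor t x) s t).trans ?_
    exact 𝒯.ext_comap_le (𝒯.map f.toFun) f.toFun Y.str s t
  have h2 : 𝒯.ext (𝒯.ext X.ev) (𝒯.e p) s ≤
      𝒯.ext Y.ev (𝒯.map (Vmap f) p) (𝒯.map f.toFun (𝒯.m s)) := by
    refine (𝒯.ext_ext_le _ _ _).trans ?_
    rw [m_e]
    refine (𝒯.ext_mono (fun h x => le_Vmap f h x) _ _).trans ?_
    exact 𝒯.ext_comap_le (Vmap f) f.toFun Y.ev _ _
  exact (mul_le_mul' h2 h1).trans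
    (le_iSup (fun t => 𝒯.ext Y.ev (𝒯.map (Vmap f) p) t * Y.str t y) _)

/-- The `𝒯`-functor `Vf : V X ⟶ V Y`. -/
def VmapHom {X Y : TCat 𝒯} (f : X ⟶ Y) : X.Vobj ⟶ Y.Vobj :=
  Hom.mk (Vmap f) fun p h => le_VStr_iff.2 fun y =>
    (mul_postcomp_le _ (X.VStr_mul_le p h) y).trans (Vmap_muMap_le f p y)

/-- The Yoneda map `x ↦ a_0 (x, -)`. -/
def yo (X : TCat 𝒯) (x : X.carrier) : X.VPow where
  val y := X.str (𝒯.e x) y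
  isFunctor := by
    rw [isFunctor_iff]
    intro t y
    rw [show 𝒯.ξT (fun y => X.str (𝒯.e x) y) t = 𝒯.ext X.str (𝒯.e (𝒯.e x)) t from
      (ext_tunit X.str (𝒯.e x) t).symm]
    have := X.trans (𝒯.e (𝒯.e x)) t y
    rwa [m_e] at this

/-- The Yoneda lemma: `⟪p, yo x⟫ = μ (p, x)`. -/
theorem VStr_yo (X : TCat 𝒯) (p : 𝒯.F X.VPow) (x : X.carrier) : X.VStr p (X.yo x) = X.mu p x := by
  apply le_antisymm
  · exact (le_mul_of_one_le_right' (X.refl x)).trans (X.VStr_mul_le p (X.yo x) x)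
  · exact le_VStr_iff.2 fun y => (X.muMap p).le_tunit x y

theorem mu_map_yo (X : TCat 𝒯) (t : 𝒯.F X.carrier) (x : X.carrier) :
    X.mu (𝒯.map X.yo t) x = X.str t x := by
  have h : ∀ s, 𝒯.ext X.ev (𝒯.map X.yo t) s = 𝒯.ext (fun x y => X.str (𝒯.e x) y) t s :=
    fun s => (𝒯.ext_comap_left X.yo X.ev t s).symm
  unfold mu relComp
  simp only [h]
  apply le_antisymm
  · refine iSup_le fun s => ?_
    rw [𝒯.ext_comap_left (fun x => 𝒯.e x) X.str]
    have := X.trans (𝒯.map (fun x => 𝒯.e x) t) s x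
    rwa [m_map_e] at this
  · refine le_iSup_of_le t (le_mul_of_one_le_left' ?_)
    exact 𝒯.one_le_ext X.refl t

/-- The Yoneda functor `X ⟶ V X`. -/
def coyoneda (X : TCat 𝒯) : X ⟶ X.Vobj :=
  Hom.mk X.yo fun t x => by
    change _ ≤ X.VStr _ _
    rw [VStr_yo, mu_map_yo]

/-- The multiplication `V V X → V X`, that is, `yo^⊛ ∘ -`. -/
def Vmult (X : TCat 𝒯) (Φ : X.Vobj.VPow) : X.VPow where
  val := postcomp (upperStar X.Vobj X.yo) Φ.val
  isFunctor := by
    have h : postcomp (upperStar X.Vobj X.yo) Φ.val = fun x => Φ.val (X.yo x) := by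
      funext x
      apply le_antisymm
      · exact postcomp_le fun t => Φ.le t _
      · refine le_trans ?_ (le_postcomp _ _ (𝒯.e (X.yo x)) x)
        rw [ξT_tunit]
        exact le_mul_of_one_le_right' (X.Vobj.refl _)
    rw [h]
    refine (isFunctor_iff X (fun x => Φ.val (X.yo x))).2 fun t x => ?_
    refine le_trans ?_ (Φ.le (𝒯.map X.yo t) (X.yo x))
    rw [ξT_map]
    exact mul_le_mul' le_rfl (X.coyoneda.isFunctor t x)

theorem Vmult_val (X : TCat 𝒯) (Φ : X.Vobj.VPow) (x : X.carrier) :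
    (X.Vmult Φ).val x = Φ.val (X.yo x) := by
  apply le_antisymm
  · exact postcomp_le fun t => Φ.le t _
  · refine le_trans ?_ (le_postcomp _ _ (𝒯.e (X.yo x)) x)
    rw [ξT_tunit]
    exact le_mul_of_one_le_right' (X.Vobj.refl _)

/-- `Φ (h) ⊗ h (x) ≤ Φ (yo x)`. -/
theorem VPow_mul_le (X : TCat 𝒯) (Φ : X.Vobj.VPow) (h : X.VPow) (x : X.carrier) :
    Φ.val h * h.val x ≤ Φ.val (X.yo x) := by
  have h1 := Φ.le_tunit h (X.yo x)
  rwa [show X.Vobj.str (𝒯.e h) (X.yo x) = h.val x from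
    (X.VStr_yo (𝒯.e h) x).trans (X.mu_tunit h x)] at h1

/-- The multiplication as a `𝒯`-functor `V V X ⟶ V X`. -/
def VmultHom (X : TCat 𝒯) : X.Vobj.Vobj ⟶ X.Vobj :=
  Hom.mk X.Vmult fun P Φ => by
    refine le_VStr_iff.2 fun x => ?_
    rw [Vmult_val]
    refine (X.Vobj.VStr_mul_le P Φ (X.yo x)).trans ?_
    refine iSup_le fun p => ?_
    rw [show X.Vobj.str p (X.yo x) = X.mu p x from X.VStr_yo p x]
    unfold mu relComp
    rw [mul_iSup_distrib]
    refine iSup_le fun t => ?_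
    rw [← mul_assoc]
    refine le_trans (mul_le_mul' ?_ le_rfl)
      (le_iSup (fun t => 𝒯.ext X.ev (𝒯.map X.Vmult P) t * X.str t x) t)
    refine (𝒯.ext_mul_ext_le _ _ _ _ _).trans ?_
    rw [← 𝒯.ext_comap_left X.Vmult X.ev]
    refine 𝒯.ext_mono (fun Φ x => ?_) _ _
    refine iSup_le fun h => ?_
    exact (X.VPow_mul_le Φ h x).trans (X.Vmult_val Φ x).ge

theorem Vmap_id (X : TCat 𝒯) (h : X.VPow) : Vmap (𝟙 X) h = h := by
  ext x
  apply le_antisymm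
  · refine postcomp_le fun t => ?_
    have := h.le t x
    have h1 : lowerStar X (𝟙 X : X ⟶ X).toFun t x = X.str t x :=
      congrArg (fun s => X.str s x) (𝒯.map_id t)
    rwa [← h1] at this
  · exact le_Vmap (𝟙 X) h x

theorem Vmap_comp {X Y Z : TCat 𝒯} (f : X ⟶ Y) (g : Y ⟶ Z) (h : X.VPow) :
    Vmap (f ≫ g) h = Vmap g (Vmap f h) := by
  ext z
  apply le_antisymm
  · refine postcomp_le fun t => ?_
    have h1 : 𝒯.ξT h.val t ≤ 𝒯.ξT (Vmap f h).val (𝒯.map f.toFun t) := by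
      rw [ξT_map]
      exact 𝒯.ξT_mono (le_Vmap f h) t
    refine (mul_le_mul' h1 ?_).trans (le_postcomp (lowerStar Z g.toFun) _ (𝒯.map f.toFun t) z)
    unfold lowerStar
    rw [map_map]
    exact le_rfl
  · refine postcomp_le fun t => ?_
    refine (mul_le_mul' (ξT_postcomp_le _ _ _) le_rfl).trans ?_
    refine iSup_mul_le fun s => ?_
    rw [mul_assoc]
    refine le_trans (mul_le_mul' le_rfl ?_) (le_postcomp _ _ (𝒯.m s) z)
    unfold lowerStar
    rw [map_m]
    refine le_trans (mul_le_mul' ?_ le_rfl) (Z.trans _ (𝒯.map g.toFun t) z)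
    rw [𝒯.ext_comap_left (𝒯.map f.toFun) Y.str]
    refine (𝒯.ext_mono (fun t x => g.isFunctor t x) _ t).trans ?_
    refine (𝒯.ext_comap_le (𝒯.map g.toFun) g.toFun Z.str _ t).trans ?_
    rw [map_map]
    refine le_of_eq ?_
    congr 2
    funext t
    exact 𝒯.map_map _ _ _

theorem Vmap_mono {X Y : TCat 𝒯} (f : X ⟶ Y) {h h' : X.VPow} (H : ∀ x, h.val x ≤ h'.val x)
    (y : Y.carrier) : (Vmap f h).val y ≤ (Vmap f h').val y :=
  postcomp_mono _ H y

theorem Vmap_yo {X Y : TCat 𝒯} (f : X ⟶ Y) (x : X.carrier) :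
    Vmap f (X.yo x) = Y.yo (f.toFun x) := by
  ext y
  apply le_antisymm
  · refine postcomp_le fun t => ?_
    have h1 : 𝒯.ξT (X.yo x).val t ≤ 𝒯.ξT (Y.yo (f.toFun x)).val (𝒯.map f.toFun t) := by
      rw [ξT_map]
      refine 𝒯.ξT_mono (fun z => ?_) t
      have := f.isFunctor (𝒯.e x) z
      rwa [map_e] at this
    exact (mul_le_mul' h1 le_rfl).trans ((Y.yo (f.toFun x)).le _ y)
  · refine le_trans ?_ (le_postcomp _ _ (𝒯.e x) y)
    rw [ξT_tunit]
    unfold lowerStar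
    rw [map_e]
    exact le_mul_of_one_le_left' (X.refl x)

/-- `w · yo_{VX} = 1`. -/
theorem Vmult_yo (X : TCat 𝒯) (h : X.VPow) : X.Vmult (X.Vobj.yo h) = h := by
  ext x
  rw [Vmult_val]
  exact (X.VStr_yo (𝒯.e h) x).trans (X.mu_tunit h x)

/-- `w · V yo_X = 1`. -/
theorem Vmult_Vmap_yo (X : TCat 𝒯) (h : X.VPow) : X.Vmult (Vmap X.coyoneda h) = h := by
  ext x
  rw [Vmult_val]
  have h1 : ∀ t, lowerStar X.Vobj X.coyoneda.toFun t (X.yo x) = X.str t x :=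
    fun t => (X.VStr_yo _ x).trans (X.mu_map_yo t x)
  apply le_antisymm
  · refine postcomp_le fun t => ?_
    rw [h1]
    exact h.le t x
  · refine le_trans ?_ (le_postcomp _ _ (𝒯.e x) _)
    rw [ξT_tunit, h1]
    exact le_mul_of_one_le_right' (X.refl x)

theorem le_yo_Vmult (X : TCat 𝒯) (Φ : X.Vobj.VPow) (h : X.VPow) :
    Φ.val h ≤ (X.Vobj.yo (X.Vmult Φ)).val h := by
  refine le_VStr_iff.2 fun x => ?_
  rw [mu_tunit, Vmult_val]
  exact X.VPow_mul_le Φ h x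

theorem Vmap_yo_Vmult_le (X : TCat 𝒯) (Φ : X.Vobj.VPow) (h : X.VPow) :
    (Vmap X.coyoneda (X.Vmult Φ)).val h ≤ Φ.val h := by
  refine postcomp_le fun t => ?_
  refine le_trans (mul_le_mul' ?_ le_rfl) (Φ.le (𝒯.map X.yo t) h)
  rw [ξT_map]
  exact 𝒯.ξT_mono (fun x => (X.Vmult_val Φ x).le) t

theorem Vmult_mono (X : TCat 𝒯) {Φ Φ' : X.Vobj.VPow} (H : ∀ h, Φ.val h ≤ Φ'.val h)
    (x : X.carrier) : (X.Vmult Φ).val x ≤ (X.Vmult Φ').val x :=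
  postcomp_mono _ H x

theorem Vmult_natural {X Y : TCat 𝒯} (f : X ⟶ Y) (Φ : X.Vobj.VPow) :
    Y.Vmult (Vmap (VmapHom f) Φ) = Vmap f (X.Vmult Φ) := by
  ext y
  apply le_antisymm
  · have h1 := Y.Vmult_mono (Vmap_mono (VmapHom f) (X.le_yo_Vmult Φ)) y
    rw [Vmap_yo, Vmult_yo] at h1
    exact h1
  · have h1 := Y.Vmult_mono (Vmap_mono (VmapHom f) (X.Vmap_yo_Vmult_le Φ)) y
    have h2 : X.coyoneda ≫ VmapHom f = f ≫ Y.coyoneda :=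
      hom_ext fun x => Vmap_yo f x
    rw [← Vmap_comp, h2, Vmap_comp, Vmult_Vmap_yo] at h1
    exact h1

theorem Vmult_assoc (X : TCat 𝒯) (Ψ : X.Vobj.Vobj.VPow) :
    X.Vmult (Vmap X.VmultHom Ψ) = X.Vmult (X.Vobj.Vmult Ψ) := by
  ext x
  apply le_antisymm
  · have h1 := X.Vmult_mono (Vmap_mono X.VmultHom (X.Vobj.le_yo_Vmult Ψ)) x
    rw [Vmap_yo, Vmult_yo] at h1
    exact h1
  · refine X.Vmult_mono (fun h => ?_) x
    have h1 : ∀ Φ, Ψ.val Φ ≤ (Vmap X.Vobj.coyoneda (Vmap X.VmultHom Ψ)).val Φ := by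
      intro Φ
      rw [← Vmap_comp]
      refine le_trans ?_ (le_postcomp _ _ (𝒯.e Φ) Φ)
      rw [ξT_tunit]
      refine le_mul_of_one_le_right' ?_
      unfold lowerStar
      rw [map_e]
      refine le_VStr_iff.2 fun h => ?_
      rw [one_mul, mu_tunit]
      exact X.le_yo_Vmult Φ h
    have h2 := X.Vobj.Vmult_mono h1 h
    rwa [Vmult_Vmap_yo] at h2

end TCat

/-- The monad `V` on the category of `𝒯`-categories, with `V X = (V^X)^op`, `V f = f_⊛ ∘ -`, the
Yoneda functors as unit and `yo^⊛ ∘ -` as multiplication. -/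
def vietorisMonad (𝒯 : TopologicalTheory V) [Subsingleton (𝒯.F PUnit.{u + 1})] :
    CategoryTheory.Monad (TCat 𝒯) where
  obj X := X.Vobj
  map f := TCat.VmapHom f
  map_id X := TCat.hom_ext fun h => X.Vmap_id h
  map_comp f g := TCat.hom_ext fun h => TCat.Vmap_comp f g h
  η :=
    { app := fun X => X.coyoneda
      naturality := fun _ _ f => TCat.hom_ext fun x => (TCat.Vmap_yo f x).symm }
  μ :=
    { app := fun X => X.VmultHom
      naturality := fun _ _ f => TCat.hom_ext fun Φ => TCat.Vmult_natural f Φ }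
  assoc X := TCat.hom_ext fun Ψ => X.Vmult_assoc Ψ
  left_unit X := TCat.hom_ext fun h => X.Vmult_yo h
  right_unit X := TCat.hom_ext fun h => X.Vmult_Vmap_yo h

/-! A limit of `h` weighted by `φ` depends only on the single element `Vh (φ)` of `VX`: the infimum
of the `hom (φ z, a (t, h z))` equals the structure of `VX` at `(T y (t), Vh (φ))`, because `Vh (φ)`
is the closure of `φ` pushed along `h` and `a (t, -)` is already closed under the structure of `X`
(`VStr_Vmap`). So all weighted limits exist as soon as the limits of the identity do, that is, as
soon as there is a map `inf : VX → X` with `a (t, inf φ)` equal to the structure of `VX` at `(T y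
(t), φ)`. Such a map is automatically a `𝒯`-functor, and the equation is the adjunction `y ⊣ inf` in
hom-set form (`isAdjoint_iff`). This gives the first claim.

For the second, the monad is of Kock-Zöberlein type: a retraction of `y` is already right adjoint to
it (`isInf_of_retract`), so the unit law of an algebra forces its structure map to be `inf`. The
carrier is then complete, and it is separated because `y` identifies equivalent functors and has a
retraction. Conversely, in a separated `X` the equation for `inf` determines it uniquely and forces
the unit and associativity laws, since both sides of each law represent the same `𝒯`-relation.
Finally, `f` is continuous exactly when `f (inf φ)` and `inf (Vf (φ))` are equivalent; by
separatedness this is the homomorphism square (`isContinuous_iff`). -/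

namespace TCat

variable {𝒯 : TopologicalTheory V}

/-- Transports a pointwise inequality `f ≤ g` through `T`, where it becomes antitone in the first
argument of the structure. The image of `t` under `y ↦ (e (f y), g y)` witnesses that `T_ξ a` is at
least `k` at `(T e (T f t), T g t)`; transitivity and `m · T e = 1` do the rest. -/
theorem le_str_of_one_le {X : TCat 𝒯} {Y : Type u} {f g : Y → X.carrier}
    (h : ∀ y, 1 ≤ X.str (𝒯.e (f y)) (g y)) (t : 𝒯.F Y) (x : X.carrier) :
    X.str (𝒯.map g t) x ≤ X.str (𝒯.map f t) x := by
  have h1 : 1 ≤ 𝒯.ext X.str (𝒯.map (fun x => 𝒯.e x) (𝒯.map f t)) (𝒯.map g t) := by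
    have h0 := 𝒯.le_ext X.str (𝒯.map (fun y => (𝒯.e (f y), g y)) t)
    rw [map_map, map_map, ξT_map] at h0
    rw [map_map]
    refine le_trans ?_ h0
    rw [← 𝒯.ξT_one t]
    exact 𝒯.ξT_mono h t
  have h2 := X.trans (𝒯.map (fun x => 𝒯.e x) (𝒯.map f t)) (𝒯.map g t) x
  rw [m_map_e] at h2
  exact (le_mul_of_one_le_left' h1).trans h2

theorem IsSeparated.hom_eq {X Y : TCat 𝒯} (hX : X.IsSeparated) {f g : Y ⟶ X}
    (h : ∀ t y, X.str t (f.toFun y) = X.str t (g.toFun y)) : f = g :=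
  hX Y f g (fun t y => (h t y).le) (fun t y => (h t y).ge)

theorem isLimit_iff {A X : TCat 𝒯} {h : A ⟶ X} {φ : 𝒯.F PUnit.{u + 1} → A.carrier → V}
    {x : X.carrier} :
    IsLimit h φ x ↔
      ∀ t, X.str t x = ⨅ z, φ (𝒯.e PUnit.unit) z ⇨ₗ X.str t (h.toFun z) :=
  ⟨fun H t => congrFun (congrFun H t) PUnit.unit, fun H => funext fun t => funext fun _ => H t⟩

/-! ### Weights as elements of `VA`, and the limit formula -/

variable [Subsingleton (𝒯.F PUnit.{u + 1})]

/-- Weights `G ⇸ A` are elements of `V^A`. -/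
def IsDistributor.toVPow {A : TCat 𝒯} {φ : 𝒯.F PUnit.{u + 1} → A.carrier → V}
    (hφ : IsDistributor (G 𝒯) A φ) : A.VPow where
  val := φ (𝒯.e PUnit.unit)
  isFunctor := by
    rw [isFunctor_iff]
    intro t x
    have h1 := (𝒯.le_kleisli A.str φ (𝒯.e (𝒯.e PUnit.unit)) t x).trans (hφ.2 _ x)
    rwa [ext_tunit, m_e] at h1

/-- As `T1 = 1`, the structure of `G` is constantly `k`, so the condition on the side of `G` is
free; the other one is the inequality characterising elements of `V^A`. -/
theorem VPow.isDistributor {A : TCat 𝒯} (h : A.VPow) :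
    IsDistributor (G 𝒯) A (fun _ => h.val) := by
  constructor
  · intro t y
    refine 𝒯.kleisli_le fun s r _ => ?_
    refine mul_le_of_le_one_left' ?_
    refine 𝒯.ext_le fun w _ _ => ?_
    rw [← 𝒯.ξT_one w]
    exact 𝒯.ξT_mono (fun p => (str_G p.1 p.2).le) w
  · intro t y
    refine 𝒯.kleisli_le fun s r _ => ?_
    refine 𝒯.ext_mul_le fun w _ h2 => ?_
    subst h2
    have := h.le (𝒯.map Prod.snd w) y
    rwa [ξT_map] at this

theorem VStr_map_yo (X : TCat 𝒯) (t : 𝒯.F X.carrier) (φ : X.VPow) :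
    X.VStr (𝒯.map X.yo t) φ = ⨅ x, φ.val x ⇨ₗ X.str t x := by
  refine eq_of_forall_le_iff fun v => ?_
  rw [le_VStr_iff]
  simp only [mu_map_yo, le_iInf_iff, leftMulResiduation_le_iff_mul_le]

/-- Reduces limits of `h` to limits of the identity: a bound `v ⊗ φ z ≤ a (t, h z)` on the
generators extends to all of `Vh (φ)`, since `a (t, -)` absorbs the structure of `X`. -/
theorem VStr_Vmap {A X : TCat 𝒯} (h : A ⟶ X) (t : 𝒯.F X.carrier) (φ : A.VPow) :
    X.VStr (𝒯.map X.yo t) (Vmap h φ) = ⨅ z, φ.val z ⇨ₗ X.str t (h.toFun z) := by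
  refine eq_of_forall_le_iff fun v => ?_
  rw [le_VStr_iff]
  simp only [mu_map_yo, le_iInf_iff, leftMulResiduation_le_iff_mul_le]
  constructor
  · exact fun H z => (mul_le_mul' le_rfl (le_Vmap h φ z)).trans (H _)
  · intro H x
    refine (mul_postcomp_le (lowerStar X h.toFun) H x).trans (postcomp_le fun s => ?_)
    -- Transitivity at the point `e t`: there `T_ξ a (e t, -)` is `ξ · T (a (t, -))`, and `m (e t) =
    -- t`.
    have h1 := X.trans (𝒯.e t) (𝒯.map h.toFun s) x
    rwa [ext_tunit, ξT_map, m_e] at h1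

theorem IsDistributor.isLimit_iff {A X : TCat 𝒯} {φ : 𝒯.F PUnit.{u + 1} → A.carrier → V}
    (hφ : IsDistributor (G 𝒯) A φ) (h : A ⟶ X) (x : X.carrier) :
    IsLimit h φ x ↔ ∀ t, X.str t x = X.VStr (𝒯.map X.yo t) (Vmap h hφ.toVPow) := by
  rw [TCat.isLimit_iff]
  simp only [VStr_Vmap]
  rfl

/-! ### Infimum maps and right adjoints of the Yoneda functor -/

/-- `inf` computes the limits of the identity. -/
def IsInf {X : TCat 𝒯} (inf : X.VPow → X.carrier) : Prop :=
  ∀ t φ, X.str t (inf φ) = X.VStr (𝒯.map X.yo t) φ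

theorem VPow.isLimit_id_iff {X : TCat 𝒯} (φ : X.VPow) (x : X.carrier) :
    IsLimit (𝟙 X) (fun _ => φ.val) x ↔ ∀ t, X.str t x = X.VStr (𝒯.map X.yo t) φ := by
  rw [TCat.isLimit_iff]
  simp only [VStr_map_yo]
  rfl

/-- Reflexivity at `inf φ`, read through the defining equation at `t = e (inf φ)`. The order of `VX`
reverses the pointwise one, so this is the counit `y · inf ≤ 1`. -/
theorem IsInf.le_yo {X : TCat 𝒯} {inf : X.VPow → X.carrier} (H : IsInf inf) (φ : X.VPow)
    (x : X.carrier) : φ.val x ≤ (X.yo (inf φ)).val x := by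
  have h1 := X.refl (inf φ)
  rw [H, map_e] at h1
  have h2 := le_VStr_iff.1 h1 x
  rwa [one_mul, mu_tunit] at h2

/-- An infimum map is a `𝒯`-functor `V X ⟶ X`. -/
def IsInf.hom {X : TCat 𝒯} {inf : X.VPow → X.carrier} (H : IsInf inf) : X.Vobj ⟶ X :=
  Hom.mk inf fun p φ => by
    -- The target becomes the structure of `VX` at `T (y · inf) p`; passing from `p` to it can only
    -- increase `μ`, because `φ ≤ y (inf φ)` pointwise.
    rw [H, map_map]
    refine le_VStr_iff.2 fun x => (X.VStr_mul_le p φ x).trans ?_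
    refine iSup_le fun t => ?_
    refine le_trans (mul_le_mul' ?_ le_rfl)
      (le_iSup (fun t => 𝒯.ext X.ev (𝒯.map (fun φ => X.yo (inf φ)) p) t * X.str t x) t)
    rw [← 𝒯.ext_comap_left (fun φ => X.yo (inf φ)) X.ev]
    exact 𝒯.ext_mono H.le_yo _ _

/-- The counit at `T y (t)`, with Yoneda, bounds `a (t, inf φ)` from above. Functoriality of `inf`
bounds it from below, up to replacing `T (inf · y) t` by `t`, which the unit permits. Conversely,
the equation at `φ = y x` is the unit and `IsInf.le_yo` is the counit. -/
theorem isAdjoint_iff {X : TCat 𝒯} (inf : X.Vobj ⟶ X) :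
    IsAdjoint X.coyoneda inf ↔ IsInf inf.toFun := by
  constructor
  · rintro ⟨h1, h2⟩ t φ
    apply le_antisymm
    · rw [← X.mu_map_yo, ← VStr_yo]
      exact h2 _ φ
    · refine (inf.isFunctor _ φ).trans ?_
      rw [map_map]
      have h3 : ∀ x, 1 ≤ X.str (𝒯.e x) (inf.toFun (X.yo x)) :=
        fun x => (X.refl x).trans (h1 _ x)
      have h4 := le_str_of_one_le (f := fun x => x) h3 t (inf.toFun φ)
      rwa [map_id] at h4
  · intro H
    constructor
    · intro t x
      change X.str t x ≤ X.str t (inf.toFun (X.yo x))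
      rw [H, VStr_yo, mu_map_yo]
    · intro p φ
      change X.VStr p (X.yo (inf.toFun φ)) ≤ X.VStr p φ
      exact le_VStr_iff.2 fun x =>
        (mul_le_mul' le_rfl (H.le_yo φ x)).trans (X.VStr_mul_le p _ x)

theorem IsInf.isLimit {A X : TCat 𝒯} {inf : X.VPow → X.carrier} (H : IsInf inf)
    {φ : 𝒯.F PUnit.{u + 1} → A.carrier → V} (hφ : IsDistributor (G 𝒯) A φ) (h : A ⟶ X) :
    IsLimit h φ (inf (Vmap h hφ.toVPow)) :=
  (hφ.isLimit_iff h _).2 fun t => H t _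

theorem IsInf.isComplete {X : TCat 𝒯} {inf : X.VPow → X.carrier} (H : IsInf inf) :
    X.IsComplete := fun _ h _ hφ => ⟨_, H.isLimit hφ h⟩

theorem IsComplete.exists_isInf {X : TCat 𝒯} (hX : X.IsComplete) :
    ∃ inf : X.VPow → X.carrier, IsInf inf := by
  choose inf h using fun φ : X.VPow => hX X (𝟙 X) (fun _ => φ.val) φ.isDistributor
  exact ⟨inf, fun t φ => (φ.isLimit_id_iff _).1 (h φ) t⟩

theorem isComplete_iff (X : TCat 𝒯) :
    X.IsComplete ↔ ∃ inf : X.Vobj ⟶ X, IsAdjoint X.coyoneda inf := by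
  constructor
  · intro hX
    obtain ⟨inf, H⟩ := hX.exists_isInf
    exact ⟨H.hom, (isAdjoint_iff H.hom).2 H⟩
  · rintro ⟨inf, H⟩
    exact ((isAdjoint_iff inf).1 H).isComplete

/-! ### Separatedness, retractions and the algebra laws -/

/-- The Yoneda map turns `f ≤ g` into a reversed pointwise inequality between `V`-valued maps, where
antisymmetry holds. -/
theorem yo_eq_of_le {X Y : TCat 𝒯} {f g : Y ⟶ X} (h1 : f ≤ g) (h2 : g ≤ f) (y : Y.carrier) :
    X.yo (f.toFun y) = X.yo (g.toFun y) := by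
  have key : ∀ {f g : Y ⟶ X}, f ≤ g → ∀ x,
      (X.yo (g.toFun y)).val x ≤ (X.yo (f.toFun y)).val x := by
    intro f g h x
    have h3 := le_str_of_one_le (fun y => (X.refl (f.toFun y)).trans (h _ y)) (𝒯.e y) x
    rwa [map_e, map_e] at h3
  ext x
  exact le_antisymm (key h2 x) (key h1 x)

theorem isSeparated_of_retract {X : TCat 𝒯} {r : X.VPow → X.carrier}
    (hr : ∀ x, r (X.yo x) = x) : X.IsSeparated := fun _ f g h1 h2 => hom_ext fun y => by
  rw [← hr (f.toFun y), ← hr (g.toFun y), yo_eq_of_le h1 h2]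

/-- A retraction `V X ⟶ X` of the Yoneda functor is right adjoint to it. -/
theorem isInf_of_retract {X : TCat 𝒯} (α : X.Vobj ⟶ X) (hα : X.coyoneda ≫ α = 𝟙 X) :
    IsInf α.toFun := by
  refine (isAdjoint_iff α).1 ⟨?_, ?_⟩
  · rw [hα]
    exact fun _ _ => le_rfl
  · intro p φ
    change X.VStr p (X.yo (α.toFun φ)) ≤ X.VStr p φ
    refine le_VStr_iff.2 fun x => (mul_le_mul' le_rfl ?_).trans (X.VStr_mul_le p _ x)
    -- Pointwise, `V y (φ) ≤ y (w (V y (φ))) = y φ`, with `y φ` taken in `VVX`. Applying `Vα` gives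
    -- `φ = V (α · y) φ ≤ Vα (y φ) = y (α φ)`, which is the counit inequality.
    have h1 := Vmap_mono α (X.le_yo_Vmult (Vmap X.coyoneda φ)) x
    rwa [Vmult_Vmap_yo, Vmap_yo, ← Vmap_comp, hα, Vmap_id] at h1

theorem IsInf.retract {X : TCat 𝒯} (hX : X.IsSeparated) {inf : X.VPow → X.carrier}
    (H : IsInf inf) : X.coyoneda ≫ H.hom = 𝟙 X :=
  hX.hom_eq fun t x => by
    change X.str t (inf (X.yo x)) = X.str t x
    rw [H, VStr_yo, mu_map_yo]

/-- Both sides represent the same relation: `v` lies below one when `v ⊗ Ψ (y x) ≤ a (t, x)` for all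
`x`, below the other when `v ⊗ Ψ φ ⊗ φ x ≤ a (t, x)` for all `φ` and `x`. These agree since `Ψ φ ⊗ φ
x ≤ Ψ (y x)`. -/
theorem IsInf.assoc {X : TCat 𝒯} (hX : X.IsSeparated) {inf : X.VPow → X.carrier}
    (H : IsInf inf) : X.VmultHom ≫ H.hom = VmapHom H.hom ≫ H.hom :=
  hX.hom_eq fun t Ψ => by
    change X.str t (inf (X.Vmult Ψ)) = X.str t (inf (Vmap H.hom Ψ))
    rw [H, H, VStr_Vmap]
    refine eq_of_forall_le_iff fun v => ?_
    change _ ↔ v ≤ ⨅ φ, Ψ.val φ ⇨ₗ X.str t (inf φ)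
    simp only [H t, le_iInf_iff, leftMulResiduation_le_iff_mul_le, le_VStr_iff, mu_map_yo,
      Vmult_val]
    constructor
    · intro h φ x
      rw [mul_assoc]
      exact (mul_le_mul' le_rfl (X.VPow_mul_le Ψ φ x)).trans (h x)
    -- Take `φ = y x`, whose value at `x` is at least `k`.
    · exact fun h x => (le_mul_of_one_le_right' (X.refl x)).trans (h (X.yo x) x)

theorem isContinuous_iff {X Y : TCat 𝒯} (hX : X.IsSeparated) (hY : Y.IsSeparated)
    {α : X.Vobj ⟶ X} {β : Y.Vobj ⟶ Y} (hα : IsInf α.toFun) (hβ : IsInf β.toFun) (f : X ⟶ Y) :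
    IsContinuous f ↔ VmapHom f ≫ β = α ≫ f := by
  constructor
  · intro hf
    refine hY.hom_eq fun t φ => ?_
    -- Only limits of the identity are needed: `f` sends `α φ` to a limit of `f` weighted by `φ`,
    -- and `β (Vf (φ))` is another one.
    have h1 := hf X (𝟙 X) _ φ.isDistributor _ ((φ.isLimit_id_iff _).2 fun t => hα t φ)
    exact ((hβ t _).trans (VStr_Vmap f t φ)).trans (TCat.isLimit_iff.1 h1 t).symm
  · intro hf A h φ hφ x hx
    have h1 : x = α.toFun (Vmap h hφ.toVPow) := by
      -- Separatedness compares functors, so the two limit points are viewed as constant functors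
      -- from `G`.
      have h2 : ∀ y : X.carrier, 𝒯.IsFunctor (G 𝒯).str X.str (fun _ => y) := by
        intro y t z
        obtain rfl : 𝒯.e PUnit.unit = t := Subsingleton.elim (α := 𝒯.F PUnit.{u + 1}) _ _
        rw [map_e, str_G]
        exact X.refl y
      have h3 : (Hom.mk _ (h2 x) : G 𝒯 ⟶ X) = Hom.mk _ (h2 (α.toFun (Vmap h hφ.toVPow))) :=
        hX.hom_eq fun t _ => ((hφ.isLimit_iff h x).1 hx t).trans (hα t _).symm
      exact congrFun (congrArg Hom.toFun h3) PUnit.unit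
    have h4 : f.toFun x = β.toFun (Vmap (h ≫ f) hφ.toVPow) := by
      rw [h1, Vmap_comp]
      exact (congrFun (congrArg Hom.toFun hf) (Vmap h hφ.toVPow)).symm
    rw [h4]
    exact hβ.isLimit hφ (h ≫ f)

end TCat

/-! ### Algebras as complete separated `𝒯`-categories -/

namespace vietorisMonad

variable (𝒯 : TopologicalTheory V) [Subsingleton (𝒯.F PUnit.{u + 1})]

variable {𝒯} in
/-- The structure map of an algebra as a `𝒯`-functor `V X ⟶ X`. -/
def algStr (A : (vietorisMonad 𝒯).Algebra) : A.A.Vobj ⟶ A.A := A.a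

variable {𝒯} in
theorem algStr_retract (A : (vietorisMonad 𝒯).Algebra) : A.A.coyoneda ≫ algStr A = 𝟙 A.A := A.unit

variable {𝒯} in
theorem isInf_algStr (A : (vietorisMonad 𝒯).Algebra) : TCat.IsInf (algStr A).toFun :=
  TCat.isInf_of_retract _ (algStr_retract A)

variable {𝒯} in
theorem isSeparated (A : (vietorisMonad 𝒯).Algebra) : A.A.IsSeparated :=
  TCat.isSeparated_of_retract fun x =>
    congrFun (congrArg TCat.Hom.toFun (algStr_retract A)) x

/-- The functor `(X, α) ↦ X` from algebras to complete separated `𝒯`-categories. -/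
def toCompleteSep : (vietorisMonad 𝒯).Algebra ⥤ CompleteSepTCat 𝒯 where
  obj A := ⟨A.A, (isInf_algStr A).isComplete, isSeparated A⟩
  map {A B} f := CompleteSepTCat.Hom.mk f.f
    ((TCat.isContinuous_iff (isSeparated A) (isSeparated B) (isInf_algStr A) (isInf_algStr B)
      f.f).2 f.h)

theorem toCompleteSep_bijective : Function.Bijective (toCompleteSep 𝒯).obj := by
  constructor
  · intro A B h
    have hB := isInf_algStr B
    have hA := isInf_algStr A
    have hs := isSeparated A
    have h1 : A.A = B.A := congrArg CompleteSepTCat.toTCat h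
    obtain ⟨X, α, _, _⟩ := A
    obtain ⟨Y, β, _, _⟩ := B
    obtain rfl : X = Y := h1
    -- Both structure maps satisfy the infimum equation, which has at most one functorial solution
    -- on a separated object.
    obtain rfl : α = β :=
      TCat.IsSeparated.hom_eq (Y := X.Vobj) hs fun t φ => (hA t φ).trans (hB t φ).symm
    rfl
  · rintro ⟨X, hc, hs⟩
    obtain ⟨inf, H⟩ := hc.exists_isInf
    exact ⟨{ A := X, a := H.hom, unit := H.retract hs, assoc := H.assoc hs }, rfl⟩

instance : (toCompleteSep 𝒯).Full where
  map_surjective {A B} g :=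
    ⟨{ f := g.hom
       h := (TCat.isContinuous_iff (isSeparated A) (isSeparated B) (isInf_algStr A)
        (isInf_algStr B) g.hom).1 g.continuous }, rfl⟩

instance : (toCompleteSep 𝒯).Faithful where
  map_injective h := Monad.Algebra.Hom.ext (congrArg CompleteSepTCat.Hom.hom h)

end vietorisMonad

theorem mainTheorem4 {V : Type u} [CommMonoid V] [CompleteLattice V] [IsQuantale V]
    (hV : (⊥ : V) ≠ 1) (𝒯 : TopologicalTheory V) [Subsingleton (𝒯.T.obj PUnit.{u + 1})] :
    (∀ X : TCat 𝒯, X.IsComplete ↔ ∃ inf : X.Vobj ⟶ X, TCat.IsAdjoint X.coyoneda inf) ∧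
    ∃ Φ : (vietorisMonad 𝒯).Algebra ⥤ CompleteSepTCat 𝒯,
      Φ ⋙ CompleteSepTCat.incl 𝒯 = (vietorisMonad 𝒯).forget ∧
      Function.Bijective Φ.obj ∧ Φ.Full ∧ Φ.Faithful :=
  ⟨TCat.isComplete_iff, vietorisMonad.toCompleteSep 𝒯, rfl,
    vietorisMonad.toCompleteSep_bijective 𝒯, inferInstance, inferInstance⟩
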